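/- Let $N\ge 1$, let $J=\begin{pmatrix}0&\mathrm{Id}_N\\-\mathrm{Id}_N&0\end{pmatrix}$, let $\Omega\subset\mathbb R^{2N}$ be open with $0\in\Omega$, and let $H\in C^2(\Omega,\mathbb R)$ with $H'(0)=0$, where $H'$ denotes the gradient. Notation. A real matrix $M$ of size $2n\times 2n$ is Hamiltonian if $M^T=JMJ$ (with the matrix $J$ of that size), and decomposable if $\mathbb R^{2n}$ is the direct sum of two proper, $M$-invariant, $J$-orthogonal symplectic subspaces. A normal form of a Hamiltonian $2N\times2N$ matrix $M$ is a matrix $$S^{-1}MS=\begin{pmatrix}\mathrm{diag}(D_1,\dots,D_s)&\mathrm{diag}(B_1,\dots,B_s)\\ \mathrm{diag}(C_1,\dots,C_s)&\mathrm{diag}(-D_1^T,\dots,-D_s^T)\end{pmatrix}$$ with $S$ symplectic, $B_j,C_j$ symmetric, $D_j,B_j,C_j$ of size $N_j\ge1$, $N_1+\dots+N_s=N$, such that each block $M_j=\begin{pmatrix}D_j&B_j\\C_j&-D_j^T\end{pmatrix}$ is an indecomposable Hamiltonian matrix and every block with spectrum $\{\pm\beta i\}$, $\beta>0$, is, for some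 $\epsilon\in\{1,-1\}$, equal to $P_{N_j}(\beta,\epsilon)$ if $N_j$ is odd and to $Q_{N_j}(\beta,\epsilon)$ if $N_j$ is even. Here $$P_n(\beta,\epsilon)=\begin{pmatrix}D&B\\-B&-D^T\end{pmatrix},$$ where $D$ has ones on the subdiagonal and zeros elsewhere, and $B$ has the entry $-(-1)^{k-1}\epsilon\beta$ at the position $(k,n+1-k)$, $k=1,\dots,n$, and zeros elsewhere; and $$Q_n(\beta,\epsilon)=\begin{pmatrix}D&0\\C&-D^T\end{pmatrix},$$ where, in $2\times2$ blocks, $D$ has $\begin{pmatrix}0&-\beta\\ \beta&0\end{pmatrix}$ on the diagonal, $\mathrm{Id}_2$ on the subdiagonal and zeros elsewhere, and $C$ has $\epsilon\,\mathrm{Id}_2$ as its last diagonal block and zeros elsewhere. For $\beta_0>0$ with $\beta_0i\in\sigma(M)$, let $o_\pm(\beta_0,M)$ (respectively $e_\pm(\beta_0,M)$) be the number of blocks $M_j=P_{N_j}(\beta_0,\pm1)$ of a normal form of $M$ with $N_j$ odd and $\frac{N_j+1}2$ odd (respectively even). Let $\mathrm i_{\mathrm B}(0,H')$ be the Brouwer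 index of the isolated zero $0$ of $H'$, that is, the Brouwer degree of $H'$ at $0$ on all sufficiently small balls around $0$. Proposition. Suppose that $H''(0)$ is positive definite. Then: 1. Every eigenvalue of $JH''(0)$ is of the form $\pm\beta i$ with $\beta>0$ and is semisimple (its algebraic and geometric multiplicities are equal), and there is at least one such pair of eigenvalues. 2. $0$ is an isolated critical point of $H$, and $\mathrm i_{\mathrm B}(0,H')=1$. 3. $JH''(0)$ has a normal form. For every normal form of $JH''(0)$ and every $\beta_0>0$ with $\beta_0i\in\sigma(JH''(0))$, all the blocks $M_j$ having the eigenvalue $\beta_0i$ are of size $2\times2$, and $$o_+(\beta_0,JH''(0))-o_-(\beta_0,JH''(0))-e_+(\beta_0,JH''(0))+e_-(\beta_0,JH''(0))\neq0 ;$$ more precisely, $o_+(\beta_0,JH''(0))=e_+(\beta_0,JH''(0))=e_-(\beta_0,JH''(0))=0$ and $o_-(\beta_0,JH''(0))>0$. -/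

import Mathlib

open scoped Topology

noncomputable section

namespace HamiltonianNF

/-! ### Hamiltonian matrices on `ℝ²ᴺ`, with coordinates `(x, y)` indexed by `Fin N ⊕ Fin N` -/

/-- The standard symplectic matrix `J = [0 Id; -Id 0]`.
(This is the negative of Mathlib's `Matrix.J`; the symplectic group is the same for both signs.) -/
def stdJ (N : ℕ) : Matrix (Fin N ⊕ Fin N) (Fin N ⊕ Fin N) ℝ :=
  Matrix.fromBlocks 0 1 (-1) 0

/-- `S` is symplectic: `S` is invertible and `Sᵀ J = J S⁻¹`, that is, `Sᵀ J S = J`. -/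
def IsSymplectic {N : ℕ} (S : Matrix (Fin N ⊕ Fin N) (Fin N ⊕ Fin N) ℝ) : Prop :=
  S.transpose * stdJ N * S = stdJ N

/-- `M` is Hamiltonian (infinitesimally symplectic). -/
def IsHamiltonian {N : ℕ} (M : Matrix (Fin N ⊕ Fin N) (Fin N ⊕ Fin N) ℝ) : Prop :=
  M.transpose = stdJ N * M * stdJ N

/-- A subspace on which the symplectic form `(v, w) ↦ vᵀ J w` is nondegenerate. -/
def IsSymplecticSubspace {N : ℕ} (V : Submodule ℝ (Fin N ⊕ Fin N → ℝ)) : Prop :=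
  ∀ v ∈ V, (∀ w ∈ V, v ⬝ᵥ (stdJ N).mulVec w = 0) → v = 0

/-- `M` is decomposable: the space is a direct sum of two proper, `M`-invariant, `J`-orthogonal
symplectic subspaces. -/
def IsDecomposable {N : ℕ} (M : Matrix (Fin N ⊕ Fin N) (Fin N ⊕ Fin N) ℝ) : Prop :=
  ∃ V₁ V₂ : Submodule ℝ (Fin N ⊕ Fin N → ℝ),
    IsCompl V₁ V₂ ∧ V₁ ≠ ⊤ ∧ V₂ ≠ ⊤ ∧
    (∀ v ∈ V₁, M.mulVec v ∈ V₁) ∧ (∀ v ∈ V₂, M.mulVec v ∈ V₂) ∧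
    (∀ v ∈ V₁, ∀ w ∈ V₂, v ⬝ᵥ (stdJ N).mulVec w = 0) ∧
    IsSymplecticSubspace V₁ ∧ IsSymplecticSubspace V₂

/-- The set of complex eigenvalues of a real square matrix. -/
def eigenvalues {ι : Type*} [Fintype ι] [DecidableEq ι] (M : Matrix ι ι ℝ) : Set ℂ :=
  spectrum ℂ (M.map Complex.ofReal)

/-- `z` is a semisimple eigenvalue of the real matrix `M`: its algebraic multiplicity equals its
geometric multiplicity (over `ℂ`). -/
def IsSemisimpleEigenvalue {ι : Type*} [Fintype ι] [DecidableEq ι] (M : Matrix ι ι ℝ) (z : ℂ) :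
    Prop :=
  z ∈ eigenvalues M ∧
    (M.map Complex.ofReal).charpoly.rootMultiplicity z =
      Module.finrank ℂ (Module.End.eigenspace (Matrix.toLin' (M.map Complex.ofReal)) z)

/-! ### The indecomposable normal forms with spectrum `{± β i}` -/

/-- The `2n × 2n` normal form block with spectrum `{± β i}` for odd `n` and `ε = ± 1`,
`[D B; -B -Dᵀ]`, where `D` has ones on the subdiagonal and `B` has the alternating entries
`-εβ, εβ, …, -εβ` on the antidiagonal (from top to bottom). -/
def oddBlock (n : ℕ) (β ε : ℝ) : Matrix (Fin n ⊕ Fin n) (Fin n ⊕ Fin n) ℝ :=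
  let D : Matrix (Fin n) (Fin n) ℝ := Matrix.of fun i j => if i.val = j.val + 1 then 1 else 0
  let B : Matrix (Fin n) (Fin n) ℝ :=
    Matrix.of fun i j => if i.val + j.val + 1 = n then -(ε * β) * (-1) ^ i.val else 0
  Matrix.fromBlocks D B (-B) (-D.transpose)

/-- The `2n × 2n` normal form block with spectrum `{± β i}` for even `n` and `ε = ± 1`,
`[D 0; C -Dᵀ]`, where, in `2 × 2` blocks, `D` has `[0 -β; β 0]` on the diagonal and the identity on
the subdiagonal, and `C` has `ε` times the identity as its last diagonal block and is `0`
elsewhere. -/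
def evenBlock (n : ℕ) (β ε : ℝ) : Matrix (Fin n ⊕ Fin n) (Fin n ⊕ Fin n) ℝ :=
  let D : Matrix (Fin n) (Fin n) ℝ := Matrix.of fun i j =>
    if Even i.val ∧ j.val = i.val + 1 then -β
    else if Odd i.val ∧ i.val = j.val + 1 then β
    else if i.val = j.val + 2 then 1
    else 0
  let C : Matrix (Fin n) (Fin n) ℝ := Matrix.of fun i j =>
    if i = j ∧ n ≤ i.val + 2 then ε else 0
  Matrix.fromBlocks D 0 C (-D.transpose)

/-- An admissible diagonal block of a normal form: an indecomposable Hamiltonian matrix of positive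
size which, if its spectrum is a purely imaginary pair `{± β i}`, `β > 0`, is one of the matrices
`oddBlock n β (± 1)`, `evenBlock n β (± 1)`. The blocks with other spectra (`{0}`, `{± α}`,
`{± α ± β i}`) play no role in the numbers defined below, so their shape is not fixed further. -/
def IsNormalBlock {n : ℕ} (M : Matrix (Fin n ⊕ Fin n) (Fin n ⊕ Fin n) ℝ) : Prop :=
  0 < n ∧ IsHamiltonian M ∧ ¬ IsDecomposable M ∧
    ∀ β : ℝ, 0 < β →
      eigenvalues M = {(β : ℂ) * Complex.I, -((β : ℂ) * Complex.I)} →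
      ∃ ε : ℝ, (ε = 1 ∨ ε = -1) ∧
        ((Odd n ∧ M = oddBlock n β ε) ∨ (Even n ∧ M = evenBlock n β ε))

/-- A normal form of `M`: a symplectic `S` such that `S⁻¹ M S` is
`[diag(D₁,…,Dₛ) diag(B₁,…,Bₛ); diag(C₁,…,Cₛ) diag(-D₁ᵀ,…,-Dₛᵀ)]`, where every
`[Dⱼ Bⱼ; Cⱼ -Dⱼᵀ]` is an admissible block and the sizes `N₁, …, Nₛ` add up to `N`. -/
structure NormalForm {N : ℕ} (M : Matrix (Fin N ⊕ Fin N) (Fin N ⊕ Fin N) ℝ) where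
  /-- The number of blocks. -/
  s : ℕ
  /-- `Nⱼ`, half the size of the `j`-th block. -/
  dim : Fin s → ℕ
  sum_dim : ∑ j, dim j = N
  D : ∀ j, Matrix (Fin (dim j)) (Fin (dim j)) ℝ
  B : ∀ j, Matrix (Fin (dim j)) (Fin (dim j)) ℝ
  C : ∀ j, Matrix (Fin (dim j)) (Fin (dim j)) ℝ
  isSymm_B : ∀ j, (B j).IsSymm
  isSymm_C : ∀ j, (C j).IsSymm
  isNormalBlock : ∀ j, IsNormalBlock (Matrix.fromBlocks (D j) (B j) (C j) (-(D j).transpose))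
  S : Matrix (Fin N ⊕ Fin N) (Fin N ⊕ Fin N) ℝ
  isSymplectic_S : IsSymplectic S
  /-- The index `(j, k)` of a block and a coordinate in it is identified with an index in `Fin N`
  by listing the blocks one after another. -/
  conj_eq :
    let e : (Σ j, Fin (dim j)) ≃ Fin N := finSigmaFinEquiv.trans (finCongr sum_dim)
    S⁻¹ * M * S =
      Matrix.fromBlocks
        (Matrix.reindex e e (Matrix.blockDiagonal' D))
        (Matrix.reindex e e (Matrix.blockDiagonal' B))
        (Matrix.reindex e e (Matrix.blockDiagonal' C))
        (Matrix.reindex e e (Matrix.blockDiagonal' fun j => -(D j).transpose))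

namespace NormalForm

variable {N : ℕ} {M : Matrix (Fin N ⊕ Fin N) (Fin N ⊕ Fin N) ℝ}

/-- The `j`-th block `Mⱼ` of the normal form. -/
def block (F : NormalForm M) (j : Fin F.s) :
    Matrix (Fin (F.dim j) ⊕ Fin (F.dim j)) (Fin (F.dim j) ⊕ Fin (F.dim j)) ℝ :=
  Matrix.fromBlocks (F.D j) (F.B j) (F.C j) (-(F.D j).transpose)

/-- The number of blocks `oddBlock Nⱼ β ε` with `Nⱼ` odd and `(Nⱼ + 1) / 2` odd;
`o₊` for `ε = 1` and `o₋` for `ε = -1`. -/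
def o (F : NormalForm M) (ε β : ℝ) : ℕ :=
  {j : Fin F.s | Odd (F.dim j) ∧ Odd ((F.dim j + 1) / 2) ∧
    F.block j = oddBlock (F.dim j) β ε}.ncard

/-- The number of blocks `oddBlock Nⱼ β ε` with `Nⱼ` odd and `(Nⱼ + 1) / 2` even;
`e₊` for `ε = 1` and `e₋` for `ε = -1`. -/
def e (F : NormalForm M) (ε β : ℝ) : ℕ :=
  {j : Fin F.s | Odd (F.dim j) ∧ Even ((F.dim j + 1) / 2) ∧
    F.block j = oddBlock (F.dim j) β ε}.ncard

/-- All the blocks of the normal form that have the eigenvalue `β i` are of dimension two. -/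
def SemisimpleAt (F : NormalForm M) (β : ℝ) : Prop :=
  ∀ j, (β : ℂ) * Complex.I ∈ eigenvalues (F.block j) → F.dim j = 1

end NormalForm

/-! ### Brouwer degree and Brouwer index of `C¹` maps -/

section Brouwer

variable {E : Type*} [NormedAddCommGroup E] [NormedSpace ℝ E]

/-- `d` is the Brouwer degree `deg(f, U, y)` of a map `f` that is continuous on the closure of the
bounded open set `U` and `C¹` on `U`, with `y ∉ f(∂U)`: for every regular value `y'` of `f|U` close
enough to `y`, the points of `U ∩ f⁻¹(y')`, counted with the signs of the Jacobian determinants,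
add up to `d`. (By Sard's theorem such `y'` exist in finite dimension, so there is at most
one `d`.) -/
def HasBrouwerDegree (f : E → E) (U : Set E) (y : E) (d : ℤ) : Prop :=
  IsOpen U ∧ Bornology.IsBounded U ∧ ContinuousOn f (closure U) ∧ ContDiffOn ℝ 1 f U ∧
    y ∉ f '' frontier U ∧
    ∀ᶠ y' in 𝓝 y, (∀ x ∈ U, f x = y' → (fderiv ℝ f x).det ≠ 0) →
      ∑ᶠ x ∈ {x | x ∈ U ∧ f x = y'}, ((SignType.sign (fderiv ℝ f x).det : SignType) : ℤ) = d

/-- `d` is the Brouwer index of the isolated zero `p` of the map `f`: the degree at `0` of `f` on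
all sufficiently small balls around `p`. -/
def HasBrouwerIndex (f : E → E) (p : E) (d : ℤ) : Prop :=
  f p = 0 ∧ (∀ᶠ x in 𝓝[≠] p, f x ≠ 0) ∧
    ∀ᶠ r in 𝓝[>] (0 : ℝ), HasBrouwerDegree f (Metric.ball p r) 0 d

end Brouwer

/-- The Hessian matrix `H''(p)`, the Jacobian matrix at `p` of the gradient `H'`. -/
def hessian {N : ℕ} (H : EuclideanSpace ℝ (Fin N ⊕ Fin N) → ℝ)
    (p : EuclideanSpace ℝ (Fin N ⊕ Fin N)) : Matrix (Fin N ⊕ Fin N) (Fin N ⊕ Fin N) ℝ :=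
  Matrix.of fun i j => (fderiv ℝ (gradient H) p (EuclideanSpace.single j 1)) i

end HamiltonianNF

end

namespace HamiltonianNF

open Matrix Module

/-! ### Skew-symmetric operators and symplectic diagonalization -/

/-! Write `A` for the positive definite Hessian.

Spectrum: since `J` is skew, `JA` is skew-adjoint for the Hermitian inner product `x* A y`
(`dotProduct_stdJ_mul_mulVec`). Hence its eigenvalues are imaginary and semisimple, and 0 is
excluded because `JA` is invertible.

Index: `det A > 0`, so near 0 the gradient is injective, open at 0 and orientation preserving. Each
value close to 0 has exactly one preimage, counted with sign `+1`.

Normal forms: by Williamson's theorem (`exists_isSymplectic_diagonal`) some symplectic `S` makes `Sᵀ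
A S = diag(ω, ω)`, and then `S⁻¹ JA S = J diag(ω, ω)` splits into planes; this is a normal form. In
an arbitrary normal form, `-J Mⱼ` is a principal submatrix of `Sᵀ A S`, hence positive definite.
Williamson applied to `Mⱼ` itself would decompose it if `Nⱼ > 1`, so `Nⱼ = 1`. For a block `P₁(β,
ε)` one has `-J P₁ = -εβ Id`, so positivity forces `ε = -1`. As `(1 + 1) / 2` is odd, only `o₋` can
be nonzero, and it is positive because `β₀ i` is an eigenvalue of some block. -/

/-- Induction on `k`, using the symmetric operator `K²` to stay over the reals. The orthogonal
complement of all `uᵢ, K uᵢ` is `K²`-invariant and nonzero by dimension, so it contains a unit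
eigenvector `v` of `K²`; its eigenvalue is `⟪v, K² v⟫ = -‖K v‖²`, whence `ω = ‖K v‖`. -/
theorem exists_orthonormal_of_skew {E : Type*} [NormedAddCommGroup E] [InnerProductSpace ℝ E]
    [FiniteDimensional ℝ E] (K : E →ₗ[ℝ] E) (hK : ∀ x y, inner ℝ (K x) y = -inner ℝ x (K y))
    (hinj : Function.Injective K) (k : ℕ) (hk : 2 * k ≤ finrank ℝ E) :
    ∃ (u : Fin k → E) (ω : Fin k → ℝ), (∀ i, 0 < ω i) ∧ (∀ i, K (K (u i)) = -(ω i) ^ 2 • u i) ∧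
      (∀ i j, inner ℝ (u i) (u j) = if i = j then (1 : ℝ) else 0) ∧
      ∀ i j, inner ℝ (u i) (K (u j)) = 0 := by
  have hself (x : E) : inner ℝ x (K x) = 0 := by
    have := hK x x
    rw [real_inner_comm] at this
    linarith
  have hsq (x y : E) : inner ℝ (K (K x)) y = inner ℝ x (K (K y)) := by
    rw [hK, hK, neg_neg]
  induction k with
  | zero => exact ⟨Fin.elim0, Fin.elim0, by simp⟩
  | succ k ih =>
    obtain ⟨u, ω, hω, hKK, hu, huK⟩ := ih (by omega)
    let L : E →ₗ[ℝ] (Fin k ⊕ Fin k → ℝ) :=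
      LinearMap.pi fun s => innerₛₗ ℝ (Sum.elim u (fun i => K (u i)) s)
    have hL (x : E) : x ∈ LinearMap.ker L ↔
        (∀ i, inner ℝ (u i) x = 0) ∧ ∀ i, inner ℝ (K (u i)) x = 0 := by
      simp [L, LinearMap.mem_ker, funext_iff]
    have hne : LinearMap.ker L ≠ ⊥ := by
      apply LinearMap.ker_ne_bot_of_finrank_lt
      simp
      omega
    have hinv : ∀ x ∈ LinearMap.ker L, (K ∘ₗ K) x ∈ LinearMap.ker L := by
      intro x hx
      rw [hL] at hx ⊢
      constructor
      · intro i
        rw [LinearMap.comp_apply, ← hsq, hKK, real_inner_smul_left, hx.1, mul_zero]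
      · intro i
        rw [LinearMap.comp_apply, ← hsq, hKK, map_smul, real_inner_smul_left, hx.2, mul_zero]
    have hsymm : (K ∘ₗ K).IsSymmetric := fun x y => hsq x y
    have : Nontrivial (LinearMap.ker L) := Submodule.nontrivial_iff_ne_bot.2 hne
    obtain ⟨w, hw⟩ :=
      (hsymm.restrict_invariant hinv).hasEigenvalue_iSup_of_finiteDimensional.exists_hasEigenvector
    -- The eigenvalue found is a supremum of Rayleigh quotients; only its being real matters.
    generalize (⨆ x : { x : LinearMap.ker L // x ≠ 0 }, _ : ℝ) = μ at hw
    have hw0 : (w : E) ≠ 0 := by simpa using hw.2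
    have hwK : K (K (w : E)) = μ • (w : E) := by
      simpa using congrArg Subtype.val hw.apply_eq_smul
    obtain ⟨hw1, hw2⟩ := (hL w).1 w.2
    set v : E := ‖(w : E)‖⁻¹ • (w : E) with hv
    have hvv : inner ℝ v v = (1 : ℝ) := by
      rw [real_inner_self_eq_norm_sq, hv, norm_smul, norm_inv, norm_norm,
        inv_mul_cancel₀ (norm_ne_zero_iff.2 hw0), one_pow]
    have hvK : K (K v) = μ • v := by
      rw [hv, map_smul, map_smul, hwK, smul_comm]
    have hv0 : v ≠ 0 := by
      rintro h
      simp [h] at hvv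
    have hKv : K v ≠ 0 := fun h => hv0 (hinj (by simpa using h))
    have hμ : μ = -‖K v‖ ^ 2 := by
      have h1 : inner ℝ v (K (K v)) = μ := by
        rw [hvK, real_inner_smul_right, hvv, mul_one]
      rw [← h1, ← real_inner_self_eq_norm_sq, hK v (K v), neg_neg]
    have hv1 (i) : inner ℝ (u i) v = 0 := by simp [hv, real_inner_smul_right, hw1]
    have hv2 (i) : inner ℝ (K (u i)) v = 0 := by simp [hv, real_inner_smul_right, hw2]
    refine ⟨Fin.cons v u, Fin.cons ‖K v‖ ω, ?_, ?_, ?_, ?_⟩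
    · exact Fin.cases (by simpa using hKv) (by simpa using hω)
    · exact Fin.cases (by simp only [Fin.cons_zero]; rw [hvK, hμ]) (by simpa using hKK)
    · refine Fin.cases (Fin.cases ?_ fun j => ?_) fun i => Fin.cases ?_ fun j => ?_
      · simpa using hvv
      · rw [if_neg (Fin.succ_ne_zero j).symm]
        simpa [real_inner_comm] using hv1 j
      · rw [if_neg (Fin.succ_ne_zero i)]
        simpa using hv1 i
      · simpa [Fin.succ_inj] using hu i j
    · refine Fin.cases (Fin.cases ?_ fun j => ?_) fun i => Fin.cases ?_ fun j => ?_
      · simpa using hself v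
      · simpa [real_inner_comm] using hv2 j
      · have := hK (u i) v
        rw [hv2] at this
        simpa using this.symm
      · simpa using huK i j

variable {N : ℕ}

theorem stdJ_eq_neg_J : stdJ N = -J (Fin N) ℝ := by
  simp [stdJ, J, fromBlocks_neg]

theorem stdJ_mul_stdJ : stdJ N * stdJ N = -1 := by
  simp [stdJ_eq_neg_J, J_squared]

theorem stdJ_transpose : (stdJ N)ᵀ = -stdJ N := by
  simp [stdJ_eq_neg_J, J_transpose]

theorem isUnit_stdJ : IsUnit (stdJ N) :=
  stdJ_eq_neg_J (N := N) ▸ ((isUnit_iff_isUnit_det _).2 (isUnit_det_J (Fin N) ℝ)).neg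

theorem isSymplectic_iff_mem {S : Matrix (Fin N ⊕ Fin N) (Fin N ⊕ Fin N) ℝ} :
    IsSymplectic S ↔ S ∈ symplecticGroup (Fin N) ℝ := by
  rw [SymplecticGroup.mem_iff', IsSymplectic, stdJ_eq_neg_J]
  simp

theorem isSymplectic_iff_mul_transpose {S : Matrix (Fin N ⊕ Fin N) (Fin N ⊕ Fin N) ℝ} :
    IsSymplectic S ↔ S * stdJ N * Sᵀ = stdJ N := by
  rw [isSymplectic_iff_mem, SymplecticGroup.mem_iff, stdJ_eq_neg_J]
  simp

theorem IsSymplectic.isUnit {S : Matrix (Fin N ⊕ Fin N) (Fin N ⊕ Fin N) ℝ} (hS : IsSymplectic S) :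
    IsUnit S :=
  (isUnit_iff_isUnit_det _).2 (SymplecticGroup.symplectic_det (isSymplectic_iff_mem.1 hS))

open scoped MatrixOrder in
theorem exists_transpose_mul_self_of_posDef {ι : Type*} [Fintype ι] [DecidableEq ι]
    {A : Matrix ι ι ℝ} (hA : A.PosDef) : ∃ B : Matrix ι ι ℝ, IsUnit B ∧ A = Bᵀ * B := by
  have h0 : 0 ≤ A := nonneg_iff_posSemidef.2 hA.posSemidef
  have h1 : CFC.sqrt A * CFC.sqrt A = A := CFC.sqrt_mul_sqrt_self A h0
  have h2 : (CFC.sqrt A)ᵀ = CFC.sqrt A := by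
    simpa [conjTranspose_eq_transpose_of_trivial] using
      (nonneg_iff_posSemidef.1 (CFC.sqrt_nonneg A)).isHermitian.eq
  refine ⟨CFC.sqrt A, ?_, by rw [h2, h1]⟩
  have := hA.isUnit
  rw [← h1] at this
  exact isUnit_of_mul_isUnit_left this

/-- **Williamson's theorem**: a positive definite matrix is diagonalized by a symplectic
congruence. -/
theorem exists_isSymplectic_diagonal {A : Matrix (Fin N ⊕ Fin N) (Fin N ⊕ Fin N) ℝ}
    (hA : A.PosDef) : ∃ (S : Matrix (Fin N ⊕ Fin N) (Fin N ⊕ Fin N) ℝ) (ω : Fin N → ℝ),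
      IsSymplectic S ∧ (∀ i, 0 < ω i) ∧ Sᵀ * A * S = diagonal (Sum.elim ω ω) := by
  obtain ⟨B, hB, rfl⟩ := exists_transpose_mul_self_of_posDef hA
  -- With `A = Bᵀ B`, try `S = B⁻¹ O R` with `O` orthogonal and `R² = diag(ω, ω)`. Then `Sᵀ A S =
  -- R²` is automatic, and `S J Sᵀ = J` amounts to `K₀ O = O J R²`, a canonical form for the skew
  -- matrix `K₀`.
  set K₀ := B * stdJ N * Bᵀ with hK₀
  have hK₀t : K₀ᵀ = -K₀ := by
    simp [hK₀, transpose_mul, stdJ_transpose, Matrix.mul_assoc]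
  have hK₀u : IsUnit K₀ := (hB.mul isUnit_stdJ).mul ((isUnit_transpose B).2 hB)
  let K := toEuclideanLin K₀
  have hKapp (x) : K x = WithLp.toLp 2 (K₀ *ᵥ x.ofLp) := rfl
  have hskew (x y) : inner ℝ (K x) y = -inner ℝ x (K y) := by
    simp only [hKapp, EuclideanSpace.inner_eq_star_dotProduct, star_trivial]
    rw [dotProduct_mulVec, ← mulVec_transpose, hK₀t, neg_mulVec, neg_dotProduct]
  obtain ⟨u, ω, hω, hKK, hu, huK⟩ := exists_orthonormal_of_skew K hskew
    (fun x y h => by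
      have : K₀ *ᵥ x.ofLp = K₀ *ᵥ y.ofLp := by simpa [hKapp] using h
      exact (WithLp.ofLp_injective 2) ((mulVec_injective_iff_isUnit.2 hK₀u) this))
    N (by simp; omega)
  -- In this order `K` sends the `i`-th vector of the first half to `-ωᵢ uᵢ` and `uᵢ` to `ωᵢ` times
  -- that vector, which are the columns of `J diag(ω, ω)`.
  let v : Fin N ⊕ Fin N → EuclideanSpace ℝ (Fin N ⊕ Fin N) :=
    Sum.elim (fun i => (ω i)⁻¹ • K (u i)) u
  let O : Matrix (Fin N ⊕ Fin N) (Fin N ⊕ Fin N) ℝ := of fun a s => v s a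
  have hO : Oᵀ * O = 1 := by
    have hOv (s t) : (Oᵀ * O) s t = inner ℝ (v s) (v t) := by
      simp [O, mul_apply, PiLp.inner_apply, mul_comm]
    ext s t
    rw [hOv, one_apply]
    rcases s with i | i <;> rcases t with j | j
    · simp only [v, Sum.elim_inl, Sum.inl.injEq, real_inner_smul_left, real_inner_smul_right, hskew,
        hKK, hu]
      split_ifs with h
      · subst h
        have := (hω i).ne'
        field_simp
      · simp
    · simp [v, real_inner_smul_left, hskew, huK]
    · simp [v, real_inner_smul_right, huK]
    · simp [v, hu]
  have hKO : K₀ * O = O * (stdJ N * diagonal (Sum.elim ω ω)) := by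
    have hKv (a s) : (K₀ * O) a s = K (v s) a := rfl
    ext a s
    rw [hKv]
    rcases s with i | i
    · have := (hω i).ne'
      simp only [v, Sum.elim_inl, map_smul, hKK]
      simp [O, v, stdJ, mul_apply, Fintype.sum_sum_type, diagonal_apply, one_apply]
      field_simp
    · have := (hω i).ne'
      simp [O, v, stdJ, mul_apply, Fintype.sum_sum_type, diagonal_apply, one_apply]
      field_simp
  have hO' : O * Oᵀ = 1 := mul_eq_one_comm.1 hO
  let R : Matrix (Fin N ⊕ Fin N) (Fin N ⊕ Fin N) ℝ :=
    diagonal (Sum.elim (fun i => √(ω i)) fun i => √(ω i))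
  have hRR : R * R = diagonal (Sum.elim ω ω) := by
    rw [diagonal_mul_diagonal]
    congr 1
    ext (i | i) <;> simp [Real.mul_self_sqrt (hω i).le]
  have hRt : Rᵀ = R := diagonal_transpose _
  have hJR : R * stdJ N = stdJ N * R := by
    ext (i | i) (j | j) <;> simp only [R, stdJ, diagonal_mul, mul_diagonal] <;> simp [one_apply] <;>
      split_ifs with h <;> simp [h]
  have e1 : B * B⁻¹ = 1 := mul_nonsing_inv _ ((isUnit_iff_isUnit_det _).1 hB)
  have e2 : B⁻¹ * B = 1 := nonsing_inv_mul _ ((isUnit_iff_isUnit_det _).1 hB)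
  have e3 : B⁻¹ᵀ * Bᵀ = 1 := by rw [← transpose_mul, e1, transpose_one]
  have e4 : Bᵀ * B⁻¹ᵀ = 1 := by rw [← transpose_mul, e2, transpose_one]
  refine ⟨B⁻¹ * O * R, ω, ?_, hω, ?_⟩
  · rw [isSymplectic_iff_mul_transpose]
    calc B⁻¹ * O * R * stdJ N * (B⁻¹ * O * R)ᵀ
        = B⁻¹ * (O * (stdJ N * (R * R))) * Oᵀ * B⁻¹ᵀ := by
          rw [transpose_mul, transpose_mul, hRt, Matrix.mul_assoc (B⁻¹ * O), hJR]
          simp only [Matrix.mul_assoc]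
      _ = B⁻¹ * K₀ * (O * Oᵀ) * B⁻¹ᵀ := by
          rw [hRR, ← hKO]
          simp only [Matrix.mul_assoc]
      _ = (B⁻¹ * B) * stdJ N * (Bᵀ * B⁻¹ᵀ) := by
          rw [hO', hK₀]
          simp only [Matrix.mul_assoc, Matrix.one_mul]
      _ = stdJ N := by rw [e2, e4, Matrix.one_mul, Matrix.mul_one]
  · calc (B⁻¹ * O * R)ᵀ * (Bᵀ * B) * (B⁻¹ * O * R)
        = R * (Oᵀ * ((B⁻¹ᵀ * Bᵀ) * (B * B⁻¹) * O)) * R := by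
          rw [transpose_mul, transpose_mul, hRt]
          simp only [Matrix.mul_assoc]
      _ = diagonal (Sum.elim ω ω) := by
          rw [e3, e1, Matrix.one_mul, Matrix.one_mul, hO, Matrix.mul_one, hRR]

end HamiltonianNF

namespace HamiltonianNF

open Matrix Module

/-! ### Spectrum of `J A` for a positive definite `A` -/

open scoped ComplexOrder

section Spectrum

variable {ι : Type*} [Fintype ι] [DecidableEq ι]

theorem mem_eigenvalues_iff {M : Matrix ι ι ℝ} {z : ℂ} :
    z ∈ eigenvalues M ↔ ∃ x : ι → ℂ, x ≠ 0 ∧ M.map Complex.ofReal *ᵥ x = z • x := by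
  rw [eigenvalues, ← Matrix.spectrum_toLin', ← End.hasEigenvalue_iff_mem_spectrum]
  constructor
  · intro h
    obtain ⟨x, hx⟩ := h.exists_hasEigenvector
    exact ⟨x, hx.2, by simpa using hx.apply_eq_smul⟩
  · rintro ⟨x, hx, hxz⟩
    exact End.hasEigenvalue_of_hasEigenvector (x := x)
      ⟨End.mem_eigenspace_iff.2 (by simpa using hxz), hx⟩

theorem star_mem_eigenvalues {M : Matrix ι ι ℝ} {z : ℂ} (hz : z ∈ eigenvalues M) :
    star z ∈ eigenvalues M := by
  obtain ⟨x, hx, hxz⟩ := mem_eigenvalues_iff.1 hz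
  refine mem_eigenvalues_iff.2 ⟨star x, star_ne_zero.2 hx, ?_⟩
  rw [← star_smul, ← hxz]
  ext i
  simp [mulVec, dotProduct]

theorem map_ofReal_mul {κ : Type*} [Fintype κ] (M M' : Matrix κ κ ℝ) :
    (M * M').map Complex.ofReal = M.map Complex.ofReal * M'.map Complex.ofReal :=
  Matrix.map_mul (f := Complex.ofRealHom)

theorem map_ofReal_one {κ : Type*} [DecidableEq κ] : (1 : Matrix κ κ ℝ).map Complex.ofReal = 1 :=
  Matrix.map_one _ Complex.ofReal_zero Complex.ofReal_one

theorem isUnit_map_ofReal {M : Matrix ι ι ℝ} (hM : IsUnit M) : IsUnit (M.map Complex.ofReal) :=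
  hM.map (Complex.ofRealHom.mapMatrix (m := ι))

theorem eigenvalues_conj {S M : Matrix ι ι ℝ} (hS : IsUnit S) :
    eigenvalues (S⁻¹ * M * S) = eigenvalues M := by
  have hdet := (isUnit_iff_isUnit_det _).1 hS
  have e1 : (S.map Complex.ofReal) * (S⁻¹.map Complex.ofReal) = 1 := by
    rw [← map_ofReal_mul, mul_nonsing_inv S hdet, map_ofReal_one]
  have e2 : (S⁻¹.map Complex.ofReal) * (S.map Complex.ofReal) = 1 := mul_eq_one_comm.1 e1
  ext z
  simp only [mem_eigenvalues_iff, map_ofReal_mul]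
  constructor
  · rintro ⟨x, hx, h⟩
    refine ⟨S.map Complex.ofReal *ᵥ x, fun h0 => hx ?_, ?_⟩
    · rw [← one_mulVec x, ← e2, ← mulVec_mulVec, h0, mulVec_zero]
    · rw [← mulVec_smul, ← h, mulVec_mulVec, mulVec_mulVec, ← Matrix.mul_assoc, ← Matrix.mul_assoc,
        e1, Matrix.one_mul]
  · rintro ⟨x, hx, h⟩
    refine ⟨S⁻¹.map Complex.ofReal *ᵥ x, fun h0 => hx ?_, ?_⟩
    · rw [← one_mulVec x, ← e1, ← mulVec_mulVec, h0, mulVec_zero]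
    · rw [← mulVec_smul, ← h, mulVec_mulVec, mulVec_mulVec, Matrix.mul_assoc, e1, Matrix.mul_one]

theorem posDef_map_ofReal {A : Matrix ι ι ℝ} (hA : A.PosDef) :
    (A.map Complex.ofReal).PosDef := by
  obtain ⟨B, hB, rfl⟩ := exists_transpose_mul_self_of_posDef hA
  have h : Bᵀ.map Complex.ofReal = (B.map Complex.ofReal)ᴴ := by
    ext i j
    simp
  rw [map_ofReal_mul, h]
  exact PosDef.conjTranspose_mul_self _ (mulVec_injective_iff_isUnit.2 (isUnit_map_ofReal hB))

/-- The hypothesis forbids Jordan chains of length two; longer chains are shortened one factor `f -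
z` at a time. -/
theorem maxGenEigenspace_eq_eigenspace_of_sq {K V : Type*} [Field K] [AddCommGroup V] [Module K V]
    {f : End K V} {z : K} (h : ∀ x, f x - z • x ∈ f.eigenspace z → x ∈ f.eigenspace z) :
    f.maxGenEigenspace z = f.eigenspace z := by
  refine le_antisymm (fun x hx => ?_) End.eigenspace_le_maxGenEigenspace
  obtain ⟨k, hk⟩ := (End.mem_maxGenEigenspace f z x).1 hx
  induction k generalizing x with
  | zero =>
    have : x = 0 := by simpa using hk
    exact this ▸ zero_mem _
  | succ k ih =>
    have hk' : ((f - z • 1) ^ k) (f x - z • x) = 0 := by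
      rw [pow_succ] at hk
      simpa using hk
    exact h x (ih _ ((End.mem_maxGenEigenspace f z _).2 ⟨k, hk'⟩) hk')

end Spectrum

variable {N : ℕ}

section PosDef

variable {A : Matrix (Fin N ⊕ Fin N) (Fin N ⊕ Fin N) ℝ}

theorem dotProduct_stdJ_mul_mulVec (hA : A.PosDef) (x y : Fin N ⊕ Fin N → ℂ) :
    star ((stdJ N * A).map Complex.ofReal *ᵥ x) ⬝ᵥ A.map Complex.ofReal *ᵥ y =
      -(star x ⬝ᵥ A.map Complex.ofReal *ᵥ ((stdJ N * A).map Complex.ofReal *ᵥ y)) := by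
  have hJ : ((stdJ N).map Complex.ofReal)ᴴ = -(stdJ N).map Complex.ofReal := by
    have h1 : ((stdJ N).map Complex.ofReal)ᴴ = (stdJ N)ᵀ.map Complex.ofReal := by
      ext i j
      simp
    rw [h1, stdJ_transpose]
    ext i j
    simp
  rw [star_mulVec, ← dotProduct_mulVec, map_ofReal_mul, conjTranspose_mul, hJ,
    (posDef_map_ofReal hA).isHermitian.eq]
  simp [mulVec_mulVec, Matrix.mul_assoc, neg_mulVec]

theorem re_eq_zero_of_mem_eigenvalues (hA : A.PosDef) {z : ℂ}
    (hz : z ∈ eigenvalues (stdJ N * A)) : z.re = 0 ∧ z ≠ 0 := by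
  obtain ⟨x, hx, hxz⟩ := mem_eigenvalues_iff.1 hz
  have hpos := (posDef_map_ofReal hA).dotProduct_mulVec_pos hx
  have h := dotProduct_stdJ_mul_mulVec hA x x
  rw [hxz, mulVec_smul, dotProduct_smul, star_smul, smul_dotProduct, smul_eq_mul, smul_eq_mul,
    ← neg_mul] at h
  have h' := mul_right_cancel₀ hpos.ne' h
  refine ⟨?_, ?_⟩
  · have := congrArg Complex.re h'
    simp at this
    linarith
  · rintro rfl
    rw [zero_smul] at hxz
    exact hx (mulVec_injective_iff_isUnit.2 (isUnit_map_ofReal (isUnit_stdJ.mul hA.isUnit))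
      (by simpa using hxz))

theorem exists_eq_of_mem_eigenvalues (hA : A.PosDef) {z : ℂ}
    (hz : z ∈ eigenvalues (stdJ N * A)) :
    ∃ β : ℝ, 0 < β ∧ (z = (β : ℂ) * Complex.I ∨ z = -((β : ℂ) * Complex.I)) := by
  obtain ⟨hre, hne⟩ := re_eq_zero_of_mem_eigenvalues hA hz
  have hz' : z = (z.im : ℂ) * Complex.I := by
    apply Complex.ext <;> simp [hre]
  rcases lt_trichotomy z.im 0 with h | h | h
  · refine ⟨-z.im, by linarith, Or.inr ?_⟩
    rw [hz']
    simp
  · exact absurd (by rw [hz', h]; simp) hne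
  · exact ⟨z.im, h, Or.inl hz'⟩

theorem isSemisimpleEigenvalue_of_posDef (hA : A.PosDef) {z : ℂ}
    (hz : z ∈ eigenvalues (stdJ N * A)) : IsSemisimpleEigenvalue (stdJ N * A) z := by
  obtain ⟨hre, -⟩ := re_eq_zero_of_mem_eigenvalues hA hz
  have hstar : star z = -z := by
    apply Complex.ext <;> simp [hre]
  refine ⟨hz, ?_⟩
  rw [← charpoly_toLin', ← LinearMap.finrank_maxGenEigenspace_eq,
    maxGenEigenspace_eq_eigenspace_of_sq]
  intro x hx
  rw [End.mem_eigenspace_iff] at hx ⊢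
  simp only [toLin'_apply] at hx ⊢
  -- The vector `y = (JA - z) x` is in the eigenspace, that is, the kernel of `JA - z`, and also in
  -- the range. As `JA - z` is skew-adjoint for imaginary `z`, these are orthogonal, so `y* A y =
  -- 0`.
  set y := (stdJ N * A).map Complex.ofReal *ᵥ x - z • x with hy
  by_contra hne
  have hy0 : y ≠ 0 := by
    rwa [hy, ne_eq, sub_eq_zero]
  apply ((posDef_map_ofReal hA).dotProduct_mulVec_pos hy0).ne'
  calc star y ⬝ᵥ A.map Complex.ofReal *ᵥ y
      = star ((stdJ N * A).map Complex.ofReal *ᵥ x) ⬝ᵥ A.map Complex.ofReal *ᵥ y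
        - star (z • x) ⬝ᵥ A.map Complex.ofReal *ᵥ y := by
        rw [← sub_dotProduct, ← star_sub, ← hy]
    _ = 0 := by
        rw [dotProduct_stdJ_mul_mulVec hA, hx, mulVec_smul, dotProduct_smul, star_smul,
          smul_dotProduct, hstar]
        simp

theorem exists_eigenvalue_pair (hN : 0 < N) (hA : A.PosDef) :
    ∃ β : ℝ, 0 < β ∧ (β : ℂ) * Complex.I ∈ eigenvalues (stdJ N * A) ∧
      -((β : ℂ) * Complex.I) ∈ eigenvalues (stdJ N * A) := by
  have : Nonempty (Fin N) := ⟨⟨0, hN⟩⟩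
  obtain ⟨z, hz⟩ := End.exists_eigenvalue (toLin' ((stdJ N * A).map Complex.ofReal))
  rw [End.hasEigenvalue_iff_mem_spectrum, spectrum_toLin'] at hz
  change z ∈ eigenvalues (stdJ N * A) at hz
  have hz' := star_mem_eigenvalues hz
  obtain ⟨β, hβ, rfl | rfl⟩ := exists_eq_of_mem_eigenvalues hA hz
  · exact ⟨β, hβ, hz, by simpa using hz'⟩
  · exact ⟨β, hβ, by simpa using hz', hz⟩

end PosDef

/-! ### Decomposability -/

theorem dotProduct_stdJ_mulVec (v w : Fin N ⊕ Fin N → ℝ) :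
    v ⬝ᵥ stdJ N *ᵥ w = ∑ i, (v (Sum.inl i) * w (Sum.inr i) - v (Sum.inr i) * w (Sum.inl i)) := by
  simp [dotProduct, mulVec, stdJ, Fintype.sum_sum_type, one_apply, Finset.sum_add_distrib,
    sub_eq_add_neg]

/-- The vectors all of whose coordinates `xᵢ, yᵢ` with `i ∉ T` vanish. -/
def coordSubspace (T : Set (Fin N)) : Submodule ℝ (Fin N ⊕ Fin N → ℝ) where
  carrier := {v | ∀ i ∉ T, v (Sum.inl i) = 0 ∧ v (Sum.inr i) = 0}
  add_mem' hv hw i hi := by simp [hv i hi, hw i hi]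
  zero_mem' i _ := by simp
  smul_mem' c v hv i hi := by simp [hv i hi]

theorem mem_coordSubspace {T : Set (Fin N)} {v : Fin N ⊕ Fin N → ℝ} :
    v ∈ coordSubspace T ↔ ∀ i ∉ T, v (Sum.inl i) = 0 ∧ v (Sum.inr i) = 0 := Iff.rfl

theorem isCompl_coordSubspace (T : Set (Fin N)) :
    IsCompl (coordSubspace T) (coordSubspace Tᶜ) := by
  classical
  refine ⟨Submodule.disjoint_def.2 fun v hv hw => ?_,
    Submodule.codisjoint_iff_exists_add_eq.2 fun v => ?_⟩
  · ext (i | i) <;> by_cases hi : i ∈ T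
    · exact (hw i (by simpa using hi)).1
    · exact (hv i hi).1
    · exact (hw i (by simpa using hi)).2
    · exact (hv i hi).2
  · refine ⟨fun s => if Sum.elim id id s ∈ T then v s else 0,
      fun s => if Sum.elim id id s ∈ T then 0 else v s, ?_, ?_, ?_⟩
    · intro i hi
      simp [hi]
    · intro i hi
      have : i ∈ T := by simpa using hi
      simp [this]
    · ext s
      by_cases h : Sum.elim id id s ∈ T <;> simp [h]

theorem coordSubspace_ne_top {T : Set (Fin N)} {i : Fin N} (hi : i ∉ T) : coordSubspace T ≠ ⊤ := by
  intro h
  have := (mem_coordSubspace.1 (h ▸ Submodule.mem_top : (fun _ => 1) ∈ coordSubspace T) i hi).1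
  simp at this

theorem isSymplecticSubspace_coordSubspace (T : Set (Fin N)) :
    IsSymplecticSubspace (coordSubspace T) := by
  intro v hv h
  ext (i | i) <;> by_cases hi : i ∈ T
  · have h1 := h (Pi.single (Sum.inr i) 1) fun j hj => by
      have : j ≠ i := fun h => hj (h ▸ hi)
      simp [this]
    rw [dotProduct_stdJ_mulVec] at h1
    simpa [Pi.single_apply] using h1
  · exact (hv i hi).1
  · have h1 := h (Pi.single (Sum.inl i) 1) fun j hj => by
      have : j ≠ i := fun h => hj (h ▸ hi)
      simp [this]
    rw [dotProduct_stdJ_mulVec] at h1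
    simpa [Pi.single_apply] using h1
  · exact (hv i hi).2

/-- Each coordinate plane `(xᵢ, yᵢ)` is invariant and symplectic. The first one is split off from
the others, of which there is at least one. -/
theorem isDecomposable_stdJ_mul_diagonal (hN : 1 < N) (ω : Fin N → ℝ) :
    IsDecomposable (stdJ N * diagonal (Sum.elim ω ω)) := by
  have hinv (T : Set (Fin N)) : ∀ v ∈ coordSubspace T,
      (stdJ N * diagonal (Sum.elim ω ω)) *ᵥ v ∈ coordSubspace T := by
    intro v hv i hi
    rw [← mulVec_mulVec]
    simp [stdJ, mulVec, dotProduct, Fintype.sum_sum_type, one_apply, diagonal_apply, hv i hi]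
  let i₀ : Fin N := ⟨0, by omega⟩
  refine ⟨coordSubspace {i₀}, coordSubspace {i₀}ᶜ, isCompl_coordSubspace _,
    coordSubspace_ne_top (i := ⟨1, hN⟩) (by simp [i₀]), coordSubspace_ne_top (i := i₀)
    (by simp), hinv _, hinv _, fun v hv w hw => ?_, isSymplecticSubspace_coordSubspace _,
    isSymplecticSubspace_coordSubspace _⟩
  rw [dotProduct_stdJ_mulVec]
  refine Finset.sum_eq_zero fun i _ => ?_
  by_cases hi : i ∈ ({i₀} : Set (Fin N))
  · simp [hw i (by simpa using hi)]
  · simp [hv i hi]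

theorem IsDecomposable.of_conj {M M' S : Matrix (Fin N ⊕ Fin N) (Fin N ⊕ Fin N) ℝ}
    (hS : IsSymplectic S) (hM : M * S = S * M') (h : IsDecomposable M') : IsDecomposable M := by
  obtain ⟨V₁, V₂, hc, h1, h2, hi1, hi2, ho, hs1, hs2⟩ := h
  let e : (Fin N ⊕ Fin N → ℝ) ≃ₗ[ℝ] (Fin N ⊕ Fin N → ℝ) :=
    LinearEquiv.ofBijective S.mulVecLin
      ⟨mulVec_injective_iff_isUnit.2 hS.isUnit, mulVec_surjective_iff_isUnit.2 hS.isUnit⟩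
  have he (v) : e v = S *ᵥ v := rfl
  have hform (v w) : e v ⬝ᵥ stdJ N *ᵥ e w = v ⬝ᵥ stdJ N *ᵥ w := by
    conv_rhs => rw [← hS]
    rw [he, he, dotProduct_comm, dotProduct_mulVec, dotProduct_comm, mulVec_mulVec,
      ← mulVec_transpose, ← mulVec_mulVec]
    simp [mulVec_mulVec, Matrix.mul_assoc]
  have hinv (V : Submodule ℝ (Fin N ⊕ Fin N → ℝ)) (hV : ∀ v ∈ V, M' *ᵥ v ∈ V) :
      ∀ v ∈ V.map e.toLinearMap, M *ᵥ v ∈ V.map e.toLinearMap := by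
    rintro _ ⟨v, hv, rfl⟩
    refine ⟨_, hV v hv, ?_⟩
    simp [he, mulVec_mulVec, hM]
  have htop (V : Submodule ℝ (Fin N ⊕ Fin N → ℝ)) (hV : V ≠ ⊤) : V.map e.toLinearMap ≠ ⊤ := by
    rw [ne_eq, Submodule.map_eq_top_iff]
    exact hV
  have hsymp (V : Submodule ℝ (Fin N ⊕ Fin N → ℝ)) (hV : IsSymplecticSubspace V) :
      IsSymplecticSubspace (V.map e.toLinearMap) := by
    rintro _ ⟨v, hv, rfl⟩ h
    have : v = 0 := hV v hv fun w hw => by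
      rw [← hform]
      exact h _ ⟨w, hw, rfl⟩
    simp [this]
  refine ⟨V₁.map e.toLinearMap, V₂.map e.toLinearMap, ?_, htop _ h1, htop _ h2, hinv _ hi1,
    hinv _ hi2, ?_, hsymp _ hs1, hsymp _ hs2⟩
  · exact hc.map (Submodule.orderIsoMapComap e)
  · rintro _ ⟨v, hv, rfl⟩ _ ⟨w, hw, rfl⟩
    exact (hform v w).trans (ho v hv w hw)

theorem stdJ_mul_mul_eq {A S : Matrix (Fin N ⊕ Fin N) (Fin N ⊕ Fin N) ℝ} (hS : IsSymplectic S) :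
    stdJ N * A * S = S * (stdJ N * (Sᵀ * A * S)) := by
  conv_lhs => rw [← isSymplectic_iff_mul_transpose.1 hS]
  simp only [Matrix.mul_assoc]

theorem isDecomposable_of_posDef (hN : 1 < N) {A : Matrix (Fin N ⊕ Fin N) (Fin N ⊕ Fin N) ℝ}
    (hA : A.PosDef) : IsDecomposable (stdJ N * A) := by
  obtain ⟨S, ω, hS, -, hSA⟩ := exists_isSymplectic_diagonal hA
  exact (isDecomposable_stdJ_mul_diagonal hN ω).of_conj hS (hSA ▸ stdJ_mul_mul_eq hS)

/-- A proper subspace of a plane has dimension at most one, and a skew form vanishes there. So a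
proper symplectic subspace is zero, and two of them cannot span. -/
theorem not_isDecomposable_of_one (M : Matrix (Fin 1 ⊕ Fin 1) (Fin 1 ⊕ Fin 1) ℝ) :
    ¬ IsDecomposable M := by
  rintro ⟨V₁, V₂, hc, h1, h2, -, -, -, hs1, hs2⟩
  have key (V : Submodule ℝ (Fin 1 ⊕ Fin 1 → ℝ)) (hV : V ≠ ⊤) (hs : IsSymplecticSubspace V) :
      V = ⊥ := by
    have hlt : finrank ℝ V ≤ 1 := by
      have := Submodule.finrank_lt hV
      simp at this
      omega
    obtain ⟨v, hv⟩ := finrank_le_one_iff.1 hlt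
    rw [Submodule.eq_bot_iff]
    intro x hx
    refine hs x hx fun y hy => ?_
    obtain ⟨c, hc⟩ := hv ⟨x, hx⟩
    obtain ⟨d, hd⟩ := hv ⟨y, hy⟩
    have hc' : c • (v : Fin 1 ⊕ Fin 1 → ℝ) = x := congrArg Subtype.val hc
    have hd' : d • (v : Fin 1 ⊕ Fin 1 → ℝ) = y := congrArg Subtype.val hd
    rw [dotProduct_stdJ_mulVec, ← hc', ← hd']
    simp
    ring
  have := hc.sup_eq_top
  rw [key V₁ h1 hs1, bot_sup_eq] at this
  exact h2 this

end HamiltonianNF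

namespace HamiltonianNF

open Matrix Module

/-! ### Normal forms of `J A` -/

variable {N : ℕ}

theorem inv_mul_stdJ_mul_mul {A S : Matrix (Fin N ⊕ Fin N) (Fin N ⊕ Fin N) ℝ}
    (hS : IsSymplectic S) : S⁻¹ * (stdJ N * A) * S = stdJ N * (Sᵀ * A * S) := by
  rw [Matrix.mul_assoc, stdJ_mul_mul_eq hS, ← Matrix.mul_assoc,
    nonsing_inv_mul _ ((isUnit_iff_isUnit_det _).1 hS.isUnit), Matrix.one_mul]

theorem IsNormalBlock.eq_one_of_posDef {n : ℕ} {M : Matrix (Fin n ⊕ Fin n) (Fin n ⊕ Fin n) ℝ}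
    (hM : IsNormalBlock M) (hpos : (-(stdJ n * M)).PosDef) : n = 1 := by
  obtain ⟨hn, -, hdec, -⟩ := hM
  have hMA : stdJ n * -(stdJ n * M) = M := by
    rw [Matrix.mul_neg, ← Matrix.mul_assoc, stdJ_mul_stdJ]
    simp
  by_contra h
  exact hdec (hMA ▸ isDecomposable_of_posDef (by omega) hpos)

theorem oddBlock_one (β ε : ℝ) : oddBlock 1 β ε =
    fromBlocks 0 (of fun _ _ => -(ε * β)) (of fun _ _ => ε * β) 0 := by
  ext (i | i) (j | j) <;> fin_cases i <;> fin_cases j <;> simp [oddBlock]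

theorem neg_stdJ_mul_fromBlocks {n : ℕ} (D B C E : Matrix (Fin n) (Fin n) ℝ) :
    -(stdJ n * fromBlocks D B C E) = fromBlocks (-C) (-E) D B := by
  simp [stdJ, fromBlocks_multiply, fromBlocks_neg]

theorem det_fin_one_sum_fin_one {R : Type*} [CommRing R]
    (M : Matrix (Fin 1 ⊕ Fin 1) (Fin 1 ⊕ Fin 1) R) :
    M.det = M (Sum.inl 0) (Sum.inl 0) * M (Sum.inr 0) (Sum.inr 0) -
      M (Sum.inl 0) (Sum.inr 0) * M (Sum.inr 0) (Sum.inl 0) := by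
  rw [← det_submatrix_equiv_self (finSumFinEquiv (m := 1) (n := 1)).symm M, det_fin_two]
  rfl

theorem mem_eigenvalues_iff_det {ι : Type*} [Fintype ι] [DecidableEq ι] {M : Matrix ι ι ℝ}
    {z : ℂ} :
    z ∈ eigenvalues M ↔ (algebraMap ℂ (Matrix ι ι ℂ) z - M.map Complex.ofReal).det = 0 := by
  rw [eigenvalues, spectrum.mem_iff, isUnit_iff_isUnit_det, isUnit_iff_ne_zero, not_not]

theorem mem_eigenvalues_fin_one {M : Matrix (Fin 1 ⊕ Fin 1) (Fin 1 ⊕ Fin 1) ℝ}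
    (hM : M (Sum.inr 0) (Sum.inr 0) = -M (Sum.inl 0) (Sum.inl 0)) {z : ℂ} :
    z ∈ eigenvalues M ↔ z ^ 2 = ((M (Sum.inl 0) (Sum.inl 0) ^ 2 +
      M (Sum.inl 0) (Sum.inr 0) * M (Sum.inr 0) (Sum.inl 0) : ℝ) : ℂ) := by
  rw [mem_eigenvalues_iff_det, det_fin_one_sum_fin_one]
  simp [hM, algebraMap_matrix_apply]
  constructor <;> intro h <;> linear_combination h

theorem IsHamiltonian.inr_inr_eq {M : Matrix (Fin 1 ⊕ Fin 1) (Fin 1 ⊕ Fin 1) ℝ}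
    (hM : IsHamiltonian M) : M (Sum.inr 0) (Sum.inr 0) = -M (Sum.inl 0) (Sum.inl 0) := by
  have := congrFun (congrFun hM (Sum.inl 0)) (Sum.inl 0)
  simp [stdJ, mul_apply, Fintype.sum_sum_type] at this
  linarith

/-- A `2 × 2` Hamiltonian matrix has trace zero, so `z²` is the same for all eigenvalues `z`. This
supplies the exact spectrum that `IsNormalBlock` asks for. -/
theorem eigenvalues_eq_pair {M : Matrix (Fin 1 ⊕ Fin 1) (Fin 1 ⊕ Fin 1) ℝ}
    (hM : IsHamiltonian M) {β : ℝ} (hβ : (β : ℂ) * Complex.I ∈ eigenvalues M) :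
    eigenvalues M = {(β : ℂ) * Complex.I, -((β : ℂ) * Complex.I)} := by
  ext z
  rw [mem_eigenvalues_fin_one hM.inr_inr_eq] at hβ ⊢
  rw [← hβ, sq_eq_sq_iff_eq_or_eq_neg]
  simp

theorem eq_of_posDef_oddBlock {n : ℕ} (hn : n = 1) {β ε : ℝ} (hβ : 0 < β) (hε : ε = 1 ∨ ε = -1)
    (hpos : (-(stdJ n * oddBlock n β ε)).PosDef) : ε = -1 := by
  subst hn
  have := hpos.diag_pos (i := Sum.inr 0)
  rw [oddBlock_one, neg_stdJ_mul_fromBlocks] at this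
  rcases hε with rfl | rfl
  · simp at this
    linarith
  · rfl

theorem IsNormalBlock.eq_oddBlock {n : ℕ} {M : Matrix (Fin n ⊕ Fin n) (Fin n ⊕ Fin n) ℝ}
    (hM : IsNormalBlock M) (hpos : (-(stdJ n * M)).PosDef) {β : ℝ} (hβ : 0 < β)
    (hmem : (β : ℂ) * Complex.I ∈ eigenvalues M) : M = oddBlock n β (-1) := by
  have hn := hM.eq_one_of_posDef hpos
  subst hn
  obtain ⟨ε, hε, ⟨-, h⟩ | ⟨h, -⟩⟩ := hM.2.2.2 β hβ (eigenvalues_eq_pair hM.2.1 hmem)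
  · rw [h] at hpos
    rw [h, eq_of_posDef_oddBlock rfl hβ hε hpos]
  · exact absurd h (by decide)

theorem isNormalBlock_oddBlock_one {β : ℝ} (hβ : 0 < β) : IsNormalBlock (oddBlock 1 β (-1)) := by
  have hH : IsHamiltonian (oddBlock 1 β (-1)) := by
    rw [oddBlock_one, IsHamiltonian, stdJ]
    ext (i | i) (j | j) <;> simp [fromBlocks_multiply]
  refine ⟨one_pos, hH, not_isDecomposable_of_one _, fun β' hβ' h => ⟨-1, Or.inr rfl,
    Or.inl ⟨odd_one, ?_⟩⟩⟩
  have h1 : (β' : ℂ) * Complex.I ∈ eigenvalues (oddBlock 1 β (-1)) := by simp [h]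
  rw [mem_eigenvalues_fin_one hH.inr_inr_eq, mul_pow, Complex.I_sq, oddBlock_one] at h1
  simp at h1
  -- `IsNormalBlock` quantifies over every `β'` with the given spectrum; positivity leaves only `β'
  -- = β`.
  have h2 : β' ^ 2 = β * β := by exact_mod_cast h1
  have h3 : β' = β := by nlinarith
  rw [h3]

/-- A matrix made of four block diagonal matrices is, after reordering, block diagonal. -/
theorem fromBlocks_blockDiagonal'_submatrix {o R : Type*} [DecidableEq o] [Zero R] {m : o → Type*}
    (D B C E : ∀ j, Matrix (m j) (m j) R) :
    (fromBlocks (blockDiagonal' D) (blockDiagonal' B) (blockDiagonal' C)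
      (blockDiagonal' E)).submatrix (Equiv.sigmaSumDistrib m m) (Equiv.sigmaSumDistrib m m) =
      blockDiagonal' fun j => fromBlocks (D j) (B j) (C j) (E j) := by
  ext ⟨j, a⟩ ⟨k, b⟩
  by_cases h : j = k
  · subst h
    rcases a with a | a <;> rcases b with b | b <;> simp
  · rcases a with a | a <;> rcases b with b | b <;> simp [blockDiagonal'_apply_ne _ _ _ h]

theorem eigenvalues_submatrix {ι κ : Type*} [Fintype ι] [DecidableEq ι] [Fintype κ]
    [DecidableEq κ] {M : Matrix ι ι ℝ} (e : κ ≃ ι) :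
    eigenvalues (M.submatrix e e) = eigenvalues M := by
  ext z
  rw [mem_eigenvalues_iff_det, mem_eigenvalues_iff_det, ← det_submatrix_equiv_self e]
  congr! 2
  ext i j
  simp [algebraMap_matrix_apply]

/-- If `z` were in no block's spectrum, inverting `z - Mⱼ` block by block would invert `z - M`. -/
theorem exists_mem_eigenvalues_of_blockDiagonal' {o : Type*} [Fintype o] [DecidableEq o]
    {m : o → Type*} [∀ j, Fintype (m j)] [∀ j, DecidableEq (m j)] {M : ∀ j, Matrix (m j) (m j) ℝ}
    {z : ℂ} (hz : z ∈ eigenvalues (blockDiagonal' M)) : ∃ j, z ∈ eigenvalues (M j) := by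
  by_contra! h
  simp only [mem_eigenvalues_iff_det, ← ne_eq] at h
  rw [eigenvalues, spectrum.mem_iff] at hz
  apply hz
  have hmap : algebraMap ℂ (Matrix (Σ j, m j) (Σ j, m j) ℂ) z -
      (blockDiagonal' M).map Complex.ofReal =
      blockDiagonal' fun j => algebraMap ℂ (Matrix (m j) (m j) ℂ) z - (M j).map Complex.ofReal := by
    rw [blockDiagonal'_map _ _ Complex.ofReal_zero]
    ext ⟨j, a⟩ ⟨k, b⟩
    by_cases h : j = k
    · subst h
      simp [algebraMap_matrix_apply]
    · simp [blockDiagonal'_apply_ne _ _ _ h, algebraMap_matrix_apply, h]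
  rw [hmap]
  apply IsUnit.of_mul_eq_one (blockDiagonal' fun j =>
    (algebraMap ℂ (Matrix (m j) (m j) ℂ) z - (M j).map Complex.ofReal)⁻¹)
  rw [← blockDiagonal'_mul, ← blockDiagonal'_one]
  congr 1
  ext1 j
  exact mul_nonsing_inv _ (isUnit_iff_ne_zero.2 (h j))

namespace NormalForm

variable {A : Matrix (Fin N ⊕ Fin N) (Fin N ⊕ Fin N) ℝ}

theorem exists_mem_eigenvalues_block {M : Matrix (Fin N ⊕ Fin N) (Fin N ⊕ Fin N) ℝ}
    (F : NormalForm M) {z : ℂ} (hz : z ∈ eigenvalues M) : ∃ j, z ∈ eigenvalues (F.block j) := by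
  rw [← eigenvalues_conj F.isSymplectic_S.isUnit, F.conj_eq] at hz
  apply exists_mem_eigenvalues_of_blockDiagonal'
  unfold block
  rw [← fromBlocks_blockDiagonal'_submatrix, eigenvalues_submatrix]
  set e : (Σ j, Fin (F.dim j)) ≃ Fin N := finSigmaFinEquiv.trans (finCongr F.sum_dim)
  rw [← eigenvalues_submatrix (e.sumCongr e)] at hz
  convert hz
  ext (i | i) (j | j) <;> simp

theorem posDef_neg_stdJ_mul_block (hA : A.PosDef) (F : NormalForm (stdJ N * A)) (j : Fin F.s) :
    (-(stdJ (F.dim j) * F.block j)).PosDef := by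
  have hS := F.isSymplectic_S
  have h2 : (F.Sᵀ * A * F.S).PosDef := by
    simpa [conjTranspose_eq_transpose_of_trivial] using
      hA.conjTranspose_mul_mul_same (mulVec_injective_iff_isUnit.2 hS.isUnit)
  have h3 : F.Sᵀ * A * F.S = -(stdJ N * (stdJ N * (F.Sᵀ * A * F.S))) := by
    rw [← Matrix.mul_assoc (stdJ N), stdJ_mul_stdJ]
    simp
  rw [← inv_mul_stdJ_mul_mul hS, F.conj_eq, neg_stdJ_mul_fromBlocks] at h3
  rw [h3] at h2
  set e : (Σ j, Fin (F.dim j)) ≃ Fin N := finSigmaFinEquiv.trans (finCongr F.sum_dim)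
  -- The positions in `Fin N` occupied by the `j`-th block; using them for both the `x` and `y`
  -- coordinates selects a principal submatrix.
  let f : Fin (F.dim j) → Fin N := fun k => e ⟨j, k⟩
  have hf : Function.Injective f := fun a b h => by simpa [f] using h
  convert h2.submatrix (Sum.map_injective.2 ⟨hf, hf⟩)
  rw [block, neg_stdJ_mul_fromBlocks]
  ext (i | i) (k | k) <;> simp [f]

theorem nonempty_of_posDef (hA : A.PosDef) : Nonempty (NormalForm (stdJ N * A)) := by
  obtain ⟨S, ω, hS, hω, hSA⟩ := exists_isSymplectic_diagonal hA
  have hblock (j) : fromBlocks 0 (of fun _ _ => ω j) (of fun _ _ => -ω j)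
      (-(0 : Matrix (Fin 1) (Fin 1) ℝ)ᵀ) = oddBlock 1 (ω j) (-1) := by
    rw [oddBlock_one]
    simp
  refine ⟨⟨N, fun _ => 1, by simp, fun _ => 0, fun j => of fun _ _ => ω j,
    fun j => of fun _ _ => -ω j, fun j => rfl, fun j => rfl,
    fun j => hblock j ▸ isNormalBlock_oddBlock_one (hω j), S, hS, ?_⟩⟩
  intro e
  -- All blocks having `Nⱼ = 1`, the enumeration of block coordinates is the identity on block
  -- indices.
  have he (j : Fin N) : e.symm j = ⟨j, 0⟩ := by
    rw [Equiv.symm_apply_eq]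
    ext
    simp [e, finSigmaFinEquiv_apply]
  rw [inv_mul_stdJ_mul_mul hS, hSA]
  ext (i | i) (j | j) <;>
    simp [stdJ, he, blockDiagonal'_apply, mul_diagonal, one_apply] <;> split_ifs with h <;> simp [h]

theorem counts_of_posDef (hA : A.PosDef) (F : NormalForm (stdJ N * A)) {β : ℝ} (hβ : 0 < β)
    (hmem : (β : ℂ) * Complex.I ∈ eigenvalues (stdJ N * A)) :
    F.SemisimpleAt β ∧ F.o 1 β = 0 ∧ F.e 1 β = 0 ∧ F.e (-1) β = 0 ∧ 0 < F.o (-1) β := by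
  have hdim (j) : F.dim j = 1 :=
    (F.isNormalBlock j).eq_one_of_posDef (posDef_neg_stdJ_mul_block hA F j)
  have he (ε : ℝ) : F.e ε β = 0 := by
    rw [e, Set.ncard_eq_zero]
    refine Set.eq_empty_of_forall_notMem fun j hj => ?_
    have := hj.2.1
    rw [hdim j] at this
    exact absurd this (by decide)
  refine ⟨fun j _ => hdim j, ?_, he 1, he (-1), ?_⟩
  · rw [o, Set.ncard_eq_zero]
    refine Set.eq_empty_of_forall_notMem fun j hj => ?_
    have hpos := posDef_neg_stdJ_mul_block hA F j
    rw [hj.2.2] at hpos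
    have := eq_of_posDef_oddBlock (hdim j) hβ (Or.inl rfl) hpos
    norm_num at this
  · obtain ⟨j, hj⟩ := F.exists_mem_eigenvalues_block hmem
    rw [o, Set.ncard_pos]
    refine ⟨j, ?_, ?_, (F.isNormalBlock j).eq_oddBlock (posDef_neg_stdJ_mul_block hA F j) hβ hj⟩
    · rw [hdim j]
      decide
    · rw [hdim j]
      decide

end NormalForm

end HamiltonianNF

namespace HamiltonianNF

open Filter Set
open scoped Topology

/-! ### Brouwer index of a nondegenerate zero -/

/-- The inverse function theorem makes `f` injective near 0 and the image of a small ball a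
neighbourhood of 0. So for values close to 0 the sum defining the degree has a single term, of sign
`+1`. -/
theorem hasBrouwerIndex_one_of_det_pos {E : Type*} [NormedAddCommGroup E] [NormedSpace ℝ E]
    [FiniteDimensional ℝ E] {f : E → E} {Ω : Set E} (hΩ : IsOpen Ω) (h0 : 0 ∈ Ω)
    (hf : ContDiffOn ℝ 1 f Ω) (hf0 : f 0 = 0) (hdet : 0 < (fderiv ℝ f 0).det) :
    HasBrouwerIndex f 0 1 := by
  have := FiniteDimensional.complete ℝ E
  have hfat : ContDiffAt ℝ 1 f 0 := hf.contDiffAt (hΩ.mem_nhds h0)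
  let f' : E ≃L[ℝ] E := (fderiv ℝ f 0).toContinuousLinearEquivOfDetNeZero hdet.ne'
  have hstrict : HasStrictFDerivAt f (f' : E →L[ℝ] E) 0 :=
    hfat.hasStrictFDerivAt (by simp)
  obtain ⟨φ, hφ0, hφf⟩ : ∃ φ : OpenPartialHomeomorph E E, 0 ∈ φ.source ∧ (φ : E → E) = f :=
    ⟨_, hstrict.mem_toOpenPartialHomeomorph_source, hstrict.toOpenPartialHomeomorph_coe⟩
  have hinj : InjOn f φ.source := hφf ▸ φ.injOn
  have hdetpos : ∀ᶠ x in 𝓝 (0 : E), 0 < (fderiv ℝ f x).det := by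
    have hc : ContinuousAt (fun x => (fderiv ℝ f x).det) 0 :=
      ContinuousLinearMap.continuous_det.continuousAt.comp
        ((hf.continuousOn_fderiv_of_isOpen hΩ le_rfl).continuousAt (hΩ.mem_nhds h0))
    exact hc.eventually (lt_mem_nhds hdet)
  -- On this ball the Jacobian determinant is positive, `f` is `C¹` and `f` is injective; radii `r <
  -- r₀` keep the closed ball inside it.
  obtain ⟨r₀, hr₀, hball⟩ := Metric.eventually_nhds_iff_ball.1
    (hdetpos.and ((hΩ.eventually_mem h0).and (φ.open_source.eventually_mem hφ0)))
  refine ⟨hf0, ?_, ?_⟩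
  · rw [eventually_nhdsWithin_iff]
    filter_upwards [φ.open_source.mem_nhds hφ0] with x hx hx0 h
    exact hx0 (hinj hx hφ0 (h.trans hf0.symm))
  filter_upwards [Ioo_mem_nhdsGT hr₀] with r hr
  have hsub : Metric.closedBall (0 : E) r ⊆ Metric.ball 0 r₀ := Metric.closedBall_subset_ball hr.2
  have hcl : closure (Metric.ball (0 : E) r) ⊆ Metric.ball 0 r₀ :=
    Metric.closure_ball_subset_closedBall.trans hsub
  have hsub' : Metric.ball (0 : E) r ⊆ Metric.ball 0 r₀ := subset_closure.trans hcl
  refine ⟨Metric.isOpen_ball, Metric.isBounded_ball,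
    hf.continuousOn.mono fun x hx => (hball x (hcl hx)).2.1,
    hf.mono fun x hx => (hball x (hsub' hx)).2.1, ?_, ?_⟩
  -- By injectivity the only zero in the closed ball is its centre, which is not on the boundary.
  · rintro ⟨x, hx, hx0⟩
    have h0x : x = 0 :=
      hinj (hball x (hcl (frontier_subset_closure hx))).2.2 hφ0 (hx0.trans hf0.symm)
    rw [h0x, Metric.isOpen_ball.frontier_eq] at hx
    exact hx.2 (Metric.mem_ball_self hr.1)
  · have hopen : f '' Metric.ball 0 r ∈ 𝓝 (0 : E) := by
      have := hstrict.map_nhds_eq_of_equiv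
      rw [hf0] at this
      rw [← this]
      exact image_mem_map (Metric.ball_mem_nhds 0 hr.1)
    filter_upwards [hopen] with y hy _
    obtain ⟨x, hx, rfl⟩ := hy
    have hset : {x' | x' ∈ Metric.ball (0 : E) r ∧ f x' = f x} = {x} := by
      ext x'
      constructor
      · rintro ⟨hx', h⟩
        exact hinj (hball x' (hsub' hx')).2.2 (hball x (hsub' hx)).2.2 h
      · rintro rfl
        exact ⟨hx, rfl⟩
    refine (finsum_mem_congr hset fun _ _ => rfl).trans ?_
    rw [finsum_mem_singleton, sign_pos (hball x (hsub' hx)).1]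
    rfl

variable {N : ℕ} {Ω : Set (EuclideanSpace ℝ (Fin N ⊕ Fin N))}
  {H : EuclideanSpace ℝ (Fin N ⊕ Fin N) → ℝ}

theorem contDiffOn_gradient (hΩ : IsOpen Ω) (hH : ContDiffOn ℝ 2 H Ω) :
    ContDiffOn ℝ 1 (gradient H) Ω :=
  (InnerProductSpace.toDual ℝ _).symm.toContinuousLinearEquiv.contDiff.comp_contDiffOn
    (hH.fderiv_of_isOpen hΩ (by norm_num))

theorem det_fderiv_gradient (p : EuclideanSpace ℝ (Fin N ⊕ Fin N)) :
    (fderiv ℝ (gradient H) p).det = (hessian H p).det := by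
  rw [ContinuousLinearMap.det, ← LinearMap.det_toMatrix (EuclideanSpace.basisFun _ ℝ).toBasis]
  congr 1

end HamiltonianNF

theorem proposition3p4 (N : ℕ) (hN : 0 < N)
    (Ω : Set (EuclideanSpace ℝ (Fin N ⊕ Fin N))) (hΩ : IsOpen Ω) (h0 : 0 ∈ Ω)
    (H : EuclideanSpace ℝ (Fin N ⊕ Fin N) → ℝ) (hH : ContDiffOn ℝ 2 H Ω)
    (hcrit : gradient H 0 = 0)
    (hpos : (HamiltonianNF.hessian H 0).PosDef) :
    -- all eigenvalues of `J H''(0)` are purely imaginary (and nonzero) and semisimple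
    (∀ z ∈ HamiltonianNF.eigenvalues (HamiltonianNF.stdJ N * HamiltonianNF.hessian H 0),
      (∃ β : ℝ, 0 < β ∧ (z = (β : ℂ) * Complex.I ∨ z = -((β : ℂ) * Complex.I))) ∧
      HamiltonianNF.IsSemisimpleEigenvalue
        (HamiltonianNF.stdJ N * HamiltonianNF.hessian H 0) z) ∧
    -- there is at least one pair of eigenvalues
    (∃ β₀ : ℝ, 0 < β₀ ∧
      (β₀ : ℂ) * Complex.I ∈
        HamiltonianNF.eigenvalues (HamiltonianNF.stdJ N * HamiltonianNF.hessian H 0) ∧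
      -((β₀ : ℂ) * Complex.I) ∈
        HamiltonianNF.eigenvalues (HamiltonianNF.stdJ N * HamiltonianNF.hessian H 0)) ∧
    -- `0` is an isolated zero of `H'`, of Brouwer index `1`
    HamiltonianNF.HasBrouwerIndex (gradient H) 0 1 ∧
    -- a normal form exists, and each one gives the asserted numbers `o₊, o₋, e₊, e₋`
    Nonempty (HamiltonianNF.NormalForm (HamiltonianNF.stdJ N * HamiltonianNF.hessian H 0)) ∧
    (∀ F : HamiltonianNF.NormalForm (HamiltonianNF.stdJ N * HamiltonianNF.hessian H 0),
      ∀ β₀ : ℝ, 0 < β₀ →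
        (β₀ : ℂ) * Complex.I ∈
          HamiltonianNF.eigenvalues (HamiltonianNF.stdJ N * HamiltonianNF.hessian H 0) →
        F.SemisimpleAt β₀ ∧
        (F.o 1 β₀ : ℤ) - F.o (-1) β₀ - F.e 1 β₀ + F.e (-1) β₀ ≠ 0 ∧
        F.o 1 β₀ = 0 ∧ F.e 1 β₀ = 0 ∧ F.e (-1) β₀ = 0 ∧ 0 < F.o (-1) β₀) := by
  refine ⟨fun z hz => ⟨HamiltonianNF.exists_eq_of_mem_eigenvalues hpos hz,
    HamiltonianNF.isSemisimpleEigenvalue_of_posDef hpos hz⟩,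
    HamiltonianNF.exists_eigenvalue_pair hN hpos,
    HamiltonianNF.hasBrouwerIndex_one_of_det_pos hΩ h0
      (HamiltonianNF.contDiffOn_gradient hΩ hH) hcrit ?_,
    HamiltonianNF.NormalForm.nonempty_of_posDef hpos, fun F β₀ hβ₀ hmem => ?_⟩
  · rw [HamiltonianNF.det_fderiv_gradient]
    exact hpos.det_pos
  · obtain ⟨hs, ho, he, he', ho'⟩ := F.counts_of_posDef hpos hβ₀ hmem
    refine ⟨hs, ?_, ho, he, he', ho'⟩
    rw [ho, he, he']
    omega
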